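/- For a finite simplicial complex $\Delta$ of dimension $d-1$ (a collection of finite sets closed under inclusion, containing $\emptyset$), let $f_i(\Delta)$ be the number of its faces of dimension $i$ (cardinality $i+1$), let $\tilde\chi(\Delta)=\sum_{i=0}^{d}(-1)^{i-1}f_{i-1}(\Delta)$, and define $h_0(\Delta),\dots,h_d(\Delta)$ by $\sum_{i=0}^d h_i(\Delta)t^i=\sum_{i=0}^d f_{i-1}(\Delta)t^i(1-t)^{d-i}$. For a matroid $M$ let $\mathcal I(M)$ be the complex of its independent sets; its dimension is the rank of $M$ minus one. For positive integers $d,k$ let $\Psi_{d,k}$ be the class of finite loopless matroids $M$ with $\dim\mathcal I(M)=d-1$ and $|\tilde\chi(\mathcal I(M))|=k$, and let $V_{d,k}$ be the graphical matroid of the multigraph obtained from a path with $d$ edges by replacing the first edge by $k+1$ parallel edges and every other edge by two parallel edges (a set of edges is independent iff it contains no cycle). Corollary. Let $d,k$ be positive integers. (a) If $M$ is a finite loopless matroid of rank $d$ with $h_d(\mathcal I(M))=k$ and $f_0(\mathcal I(M))=2d+h_d(\mathcal I(M))-1$, then $M$ is isomorphic to $V_{d,k}$. (b) Consequently $V_{d,k}$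 is, up to isomorphism, the unique maximizer of the number of elements in $\Psi_{d,k}$: $V_{d,k}\in\Psi_{d,k}$, it has exactly $2d+k-1$ elements, and every $M\in\Psi_{d,k}$ has at most as many elements as $V_{d,k}$, with equality if and only if $M\cong V_{d,k}$. -/

import Mathlib

namespace ExtremalMatroid

open Polynomial

/-! ### Simplicial complexes, face numbers and `h`-numbers -/

/-- The faces of a simplicial complex form a family of finite sets closed under inclusion; the empty
face is allowed (it is the unique face of dimension `-1`). Only complexes with finitely many faces
are considered below. -/
abbrev Complex (α : Type*) := LowerSet (Finset α)

/-- `f_i(Δ)`: the number of faces of dimension `i`, i.e. of cardinality `i + 1`, for `i ≥ -1`. -/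
noncomputable def fNumber {α : Type*} (Δ : Complex α) (i : ℤ) : ℕ :=
  {F : Finset α | F ∈ Δ ∧ (F.card : ℤ) - 1 = i}.ncard

/-- The maximal cardinality of a face. -/
noncomputable def maxCard {α : Type*} (Δ : Complex α) : ℕ :=
  sSup {n : ℕ | ∃ F ∈ Δ, F.card = n}

/-- The dimension of a complex: one less than the maximal cardinality of a face. -/
noncomputable def dim {α : Type*} (Δ : Complex α) : ℤ := (maxCard Δ : ℤ) - 1

/-- The `h`-polynomial `∑_{i=0}^d f_{i-1} t^i (1-t)^{d-i}`, where `d = dim Δ + 1`. -/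
noncomputable def hPoly {α : Type*} (Δ : Complex α) : ℤ[X] :=
  ∑ i ∈ Finset.range (maxCard Δ + 1),
    C (fNumber Δ ((i : ℤ) - 1) : ℤ) * X ^ i * (1 - X) ^ (maxCard Δ - i)

/-- The `h`-number `h_i(Δ)`. -/
noncomputable def hNumber {α : Type*} (Δ : Complex α) (i : ℕ) : ℤ := (hPoly Δ).coeff i

/-- The reduced Euler characteristic `∑_{i=0}^d (-1)^{i-1} f_{i-1}`, where `d = dim Δ + 1`. -/
noncomputable def reducedEuler {α : Type*} (Δ : Complex α) : ℤ :=
  ∑ i ∈ Finset.range (maxCard Δ + 1), (-1) ^ (i + 1) * (fNumber Δ ((i : ℤ) - 1) : ℤ)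

/-! ### Matroids -/

/-- The independence complex `𝓘(M)`. -/
def indepComplex {α : Type*} (M : Matroid α) : Complex α where
  carrier := {I | M.Indep (I : Set α)}
  lower' := fun _ _ hJI hI => hI.subset (Finset.coe_subset.2 hJI)

/-- The isomorphism class of `M` belongs to `Ψ_{d,k}`: `M` is a finite loopless matroid with
`dim 𝓘(M) = d - 1` (i.e. of rank `d`) and `|χ̃(𝓘(M))| = k`. -/
def MemPsi {α : Type*} (M : Matroid α) (d k : ℕ) : Prop :=
  M.Finite ∧ M.Loopless ∧ dim (indepComplex M) = (d : ℤ) - 1 ∧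
    |reducedEuler (indepComplex M)| = (k : ℤ)

/-- Isomorphism of matroids: a bijection of the ground sets preserving independence both ways. -/
def IsIso {α β : Type*} (M : Matroid α) (N : Matroid β) : Prop :=
  ∃ e : M.E ≃ N.E, ∀ I : Set M.E,
    M.Indep (Subtype.val '' I) ↔ N.Indep (Subtype.val '' (e '' I))

/-! ### Graphical matroids and `V_{d,k}` -/

/-- `F` contains (the edge set of) a cycle of the multigraph `G`: there are `n + 1 ≥ 1` distinct
vertices `v 0, …, v n` and distinct edges `e 0, …, e n` in `F` such that `e i` joins `v i` to
`v (i + 1)`, indices being cyclic. For `n = 0` this is a loop, for `n = 1` a pair of parallel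
edges. -/
def ContainsCycle {V E : Type*} (G : Graph V E) (F : Set E) : Prop :=
  ∃ (n : ℕ) (v : Fin (n + 1) → V) (e : Fin (n + 1) → E),
    Function.Injective v ∧ Function.Injective e ∧
      ∀ i, e i ∈ F ∧ G.IsLink (e i) (v i) (v (i + 1))

/-- The edges of a path of length `d` whose first edge is replaced by `k + 1` parallel edges and
whose other edges are doubled: the pair `⟨i, j⟩` is the `j`-th copy of the `i`-th edge. -/
abbrev VEdge (d k : ℕ) := Σ i : Fin d, Fin (if (i : ℕ) = 0 then k + 1 else 2)

/-- The path with vertices `0, …, d` in which the edge from `0` to `1` has `k + 1` parallel copies,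
and the edge from `i` to `i + 1` has two parallel copies for `1 ≤ i < d`. -/
def vGraph (d k : ℕ) : Graph (Fin (d + 1)) (VEdge d k) where
  vertexSet := Set.univ
  IsLink e x y := (x = e.1.castSucc ∧ y = e.1.succ) ∨ (x = e.1.succ ∧ y = e.1.castSucc)
  isLink_symm := fun _ _ => ⟨fun _ _ h => by tauto⟩
  eq_or_eq_of_isLink_of_isLink := by
    rintro e x y v w (⟨rfl, rfl⟩ | ⟨rfl, rfl⟩) (⟨rfl, rfl⟩ | ⟨rfl, rfl⟩) <;> simp
  left_mem_of_isLink := fun _ _ _ _ => Set.mem_univ _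

/-- A set of edges of `vGraph d k` is a forest iff it has at most one edge from each parallel
class. -/
theorem not_containsCycle_vGraph_iff {d k : ℕ} {F : Set (VEdge d k)} :
    ¬ ContainsCycle (vGraph d k) F ↔ Set.InjOn Sigma.fst F := by
  constructor
  · intro h a ha b hb hab
    by_contra hne
    refine h ⟨1, ![a.1.castSucc, a.1.succ], ![a, b], ?_, ?_, ?_⟩
    · have hlt := Fin.castSucc_lt_succ (i := a.1)
      intro i j hij
      fin_cases i <;> fin_cases j <;> simp_all [Fin.ext_iff]
    · intro i j hij
      fin_cases i <;> fin_cases j <;> simp_all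
    · intro i
      fin_cases i
      · exact ⟨ha, Or.inl ⟨rfl, rfl⟩⟩
      · refine ⟨hb, Or.inr ⟨?_, ?_⟩⟩
        · simp [hab]
        · simp [hab]
  · rintro h ⟨n, v, e, -, he, hl⟩
    obtain ⟨i, -, hi⟩ := Finset.exists_max_image Finset.univ v ⟨0, Finset.mem_univ _⟩
    have h1 := (hl i).2
    have h2 := (hl (i - 1)).2
    rw [sub_add_cancel] at h2
    have m1 := hi (i + 1) (Finset.mem_univ _)
    have m2 := hi (i - 1) (Finset.mem_univ _)
    have e1 : v i = (e i).1.succ := by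
      rcases h1 with ⟨a, b⟩ | ⟨a, b⟩
      · rw [a, b] at m1
        exact absurd m1 (not_le.2 Fin.castSucc_lt_succ)
      · exact a
    have e2 : v i = (e (i - 1)).1.succ := by
      rcases h2 with ⟨a, b⟩ | ⟨a, b⟩
      · exact b
      · rw [a, b] at m2
        exact absurd m2 (not_le.2 Fin.castSucc_lt_succ)
    have e3 : e i = e (i - 1) :=
      h (hl i).1 (hl (i - 1)).1 (Fin.succ_injective _ (e1.symm.trans e2))
    have e4 : i + 1 = i := by
      have := he e3
      nth_rewrite 1 [this]
      exact sub_add_cancel i 1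
    rw [e4] at h1
    rcases h1 with ⟨a, b⟩ | ⟨a, b⟩
    · exact absurd (a.symm.trans b) Fin.castSucc_lt_succ.ne
    · exact absurd (b.symm.trans a) Fin.castSucc_lt_succ.ne

/-- The matroid `V_{d,k}` (for `d, k ≥ 1`): the graphical matroid of `vGraph d k`, whose independent
sets are the sets of edges that contain no cycle. -/
def V (d k : ℕ) : Matroid (VEdge d k) :=
  (IndepMatroid.ofFinite (E := Set.univ) Set.finite_univ
    (fun F => ¬ ContainsCycle (vGraph d k) F)
    (by rw [not_containsCycle_vGraph_iff]; exact Set.injOn_empty _)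
    (by
      intro I J hJ hIJ
      rw [not_containsCycle_vGraph_iff] at hJ ⊢
      exact hJ.mono hIJ)
    (by
      intro I J hI hJ hlt
      simp only [not_containsCycle_vGraph_iff] at hI hJ ⊢
      rw [← hI.ncard_image, ← hJ.ncard_image] at hlt
      obtain ⟨x, ⟨e, heJ, rfl⟩, hx⟩ := Set.exists_mem_notMem_of_ncard_lt_ncard hlt
      have heI : e ∉ I := fun h => hx ⟨e, h, rfl⟩
      exact ⟨e, heJ, heI, (Set.injOn_insert heI).2 ⟨hI, hx⟩⟩)
    (fun _ _ => Set.subset_univ _)).matroid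

end ExtremalMatroid

namespace ExtremalMatroid

open Polynomial Set

variable {α : Type*}

/-! ### The alternating sum over the independent sets -/

/-! For a matroid of rank `d`, `h_d` is `(-1)^d ∑ (-1)^|I|` over the independent sets, hence equals
the reduced Euler characteristic up to sign. Let `P` be the parallel class of an element. An
independent set either avoids `P` or is one element of `P` added to an independent set of `M / P`,
which gives `h(M) = h(M \ P) + |P| h(M / P)`, both terms taken with the signs of `M`'s rank and one
less.

Induction on the number of elements (`topH_bounds`) shows `h ≥ 0` always, and `h ≥ 1`, `|E| ≤ 2d + h
- 1` without coloops. If some base avoids `P`, then `h(M) ≥ |P| b ≥ |P| + b - 1` with `b = h(M / P)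
≥ 1`, and the bound is strict. Otherwise `P` is a direct summand, `h(M) = (|P| - 1) b` with `|P| ≥
2`, and the slack gained over `M / P` is `(|P| - 2)(b - 1) ≥ 0`. Equality thus forces a direct sum
of parallel classes, all of size 2 except possibly one, which is `V d k`. A coloop would give `h =
0`, so `k ≥ 1` excludes it. -/

theorem finite_indep (M : Matroid α) [M.Finite] : {I : Finset α | M.Indep (I : Set α)}.Finite := by
  classical
  refine (M.ground_finite.toFinset.powerset.finite_toSet).subset fun I hI => ?_
  have hI' : (I : Set α) ⊆ M.E := Matroid.Indep.subset_ground hI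
  simpa [← Finset.coe_subset] using hI'

/-- The finset of independent sets of a finite matroid. -/
noncomputable def indepSets (M : Matroid α) [M.Finite] : Finset (Finset α) :=
  (finite_indep M).toFinset

@[simp] theorem mem_indepSets {M : Matroid α} [M.Finite] {I : Finset α} :
    I ∈ indepSets M ↔ M.Indep (I : Set α) := by
  simp [indepSets]

/-- The alternating sum `∑ (-1)^{|I|}` over the independent sets. -/
noncomputable def altSum (M : Matroid α) [M.Finite] : ℤ := ∑ I ∈ indepSets M, (-1) ^ I.card

theorem altSum_congr {M N : Matroid α} [M.Finite] [N.Finite]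
    (h : ∀ I : Set α, M.Indep I ↔ N.Indep I) : altSum M = altSum N := by
  unfold altSum
  congr 1
  ext I
  simp [h]

/-! ### Parallel classes -/

/-- Every element of a parallel class spans it, so any `x` in the class can serve as the basis used
to test independence in the contraction. -/
theorem contract_closure_indep_iff {M : Matroid α} [M.Loopless] {e x : α}
    (hx : x ∈ M.closure {e}) {J : Set α} :
    (M.contract (M.closure {e})).Indep J ↔ M.Indep (insert x J) ∧ Disjoint (M.closure {e}) J := by
  have hxE : x ∈ M.E := M.closure_subset_ground _ hx
  have hxn : M.IsNonloop x := M.isNonloop_of_loopless hxE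
  rw [← hxn.closure_eq_of_mem_closure hx, (hxn.indep.isBasis_closure).contract_indep_iff,
    union_singleton]

theorem subsingleton_inter_closure {M : Matroid α} [M.Loopless] {e : α} {I : Set α}
    (hI : M.Indep I) : (I ∩ M.closure {e}).Subsingleton := by
  rintro x ⟨hxI, hx⟩ y ⟨hyI, hy⟩
  by_contra hne
  have hyn : M.IsNonloop y := M.isNonloop_of_loopless (M.closure_subset_ground _ hy)
  rw [← hyn.closure_eq_of_mem_closure hy] at hx
  exact hI.notMem_closure_sdiff_of_mem hxI
    (M.closure_subset_closure (by simpa using ⟨hyI, Ne.symm hne⟩) hx)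

theorem contract_closure_loopless (M : Matroid α) (X : Set α) :
    (M.contract (M.closure X)).Loopless := ⟨by
  rw [Matroid.contract_loops_eq, M.closure_closure, sdiff_self]⟩

theorem delete_loopless (M : Matroid α) [M.Loopless] (X : Set α) : (M.delete X).Loopless :=
  (M.delete_isRestriction X).loopless

/-- A base containing `e` has no other element in the class of `e`, so removing `e` leaves a base of
the contraction. -/
theorem eRank_contract_closure {M : Matroid α} [M.Loopless] {e : α} (he : e ∈ M.E) :
    (M.contract (M.closure {e})).eRank + 1 = M.eRank := by
  have hee : e ∈ M.closure {e} := M.mem_closure_of_mem (mem_singleton e) (by simpa using he)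
  obtain ⟨B', hB'⟩ := (M.contract (M.closure {e})).exists_isBase
  obtain ⟨h1, h2⟩ := (contract_closure_indep_iff hee).1 hB'.indep
  have heB' : e ∉ B' := fun h => disjoint_left.1 h2 hee h
  obtain ⟨B, hB, hsub⟩ := h1.exists_isBase_superset
  have heB : e ∈ B := hsub (mem_insert _ _)
  have hind : (M.contract (M.closure {e})).Indep (B \ {e}) := by
    rw [contract_closure_indep_iff hee]
    refine ⟨by simpa [insert_eq_of_mem heB] using hB.indep, disjoint_left.2 ?_⟩
    rintro x hx ⟨hxB, hxe⟩
    exact hxe (subsingleton_inter_closure hB.indep ⟨hxB, hx⟩ ⟨heB, hee⟩)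
  have heq : B' = B \ {e} := hB'.eq_of_subset_indep hind
    fun x hx => ⟨hsub (mem_insert_of_mem _ hx), fun h => heB' (by rwa [mem_singleton_iff.1 h] at hx)⟩
  rw [← hB.encard_eq_eRank, ← hB'.encard_eq_eRank, heq, encard_sdiff_singleton_add_one heB]

theorem eRank_delete_of_disjoint {M : Matroid α} {B X : Set α} (hB : M.IsBase B)
    (hd : Disjoint B X) : (M.delete X).eRank = M.eRank := by
  have h : (M.delete X).IsBase B := by
    rw [Matroid.delete_isBase_iff]
    exact hB.isBasis_of_subset sdiff_subset (subset_sdiff.2 ⟨hB.subset_ground, hd⟩)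
  rw [← h.encard_eq_eRank, hB.encard_eq_eRank]

/-- If every base meets the parallel class of `e`, the class is a direct summand. -/
theorem delete_indep_iff_contract_indep {M : Matroid α} [M.Loopless] {e : α} (he : e ∈ M.E)
    (h : ∀ B, M.IsBase B → ¬ Disjoint B (M.closure {e})) (J : Set α) :
    (M.delete (M.closure {e})).Indep J ↔ (M.contract (M.closure {e})).Indep J := by
  rw [Matroid.delete_indep_iff]
  constructor
  · rintro ⟨hJ, hd⟩
    obtain ⟨B, hB, hsub⟩ := hJ.exists_isBase_superset
    obtain ⟨x, hxB, hx⟩ := not_disjoint_iff.1 (h B hB)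
    exact (contract_closure_indep_iff hx).2
      ⟨hB.indep.subset (insert_subset hxB hsub), hd.symm⟩
  · intro hJ
    have hee : e ∈ M.closure {e} := M.mem_closure_of_mem (mem_singleton e) (by simpa using he)
    obtain ⟨h1, h2⟩ := (contract_closure_indep_iff hee).1 hJ
    exact ⟨h1.subset (subset_insert _ _), h2.symm⟩

/-! ### Deletion–contraction along a parallel class -/

theorem altSum_eq_delete_sub_contract (M : Matroid α) [M.Finite] [M.Loopless] {e : α} :
    altSum M = altSum (M.delete (M.closure {e}))
      - (M.closure {e}).ncard * altSum (M.contract (M.closure {e})) := by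
  classical
  have hfin : (M.closure {e}).Finite := M.ground_finite.subset (M.closure_subset_ground _)
  have h1 : altSum (M.delete (M.closure {e})) =
      ∑ I ∈ (indepSets M).filter (fun I : Finset α => Disjoint (I : Set α) (M.closure {e})), (-1) ^ I.card := by
    unfold altSum
    congr 1
    ext I
    simp [Matroid.delete_indep_iff]
  have h2 : (-((M.closure {e}).ncard * altSum (M.contract (M.closure {e}))) : ℤ) =
      ∑ I ∈ (indepSets M).filter (fun I : Finset α => ¬ Disjoint (I : Set α) (M.closure {e})), (-1) ^ I.card := by
    have : (-((M.closure {e}).ncard * altSum (M.contract (M.closure {e}))) : ℤ) =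
        ∑ q ∈ hfin.toFinset ×ˢ indepSets (M.contract (M.closure {e})), (-1) ^ (q.2.card + 1) := by
      rw [Finset.sum_product]
      simp only [pow_succ, mul_neg, mul_one, Finset.sum_neg_distrib, Finset.sum_const, altSum,
        ncard_eq_toFinset_card _ hfin, nsmul_eq_mul]
    rw [this]
    -- The inverse splits off the unique element of `I` in the class; the default `e` is never
    -- reached, since `I` meets the class.
    refine Finset.sum_bij' (fun q _ => insert q.1 q.2)
      (fun I _ => (if h : ((I : Set α) ∩ M.closure {e}).Nonempty then h.some else e,
        I.filter (· ∉ M.closure {e}))) ?_ ?_ ?_ ?_ ?_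
    · rintro ⟨x, J⟩ hq
      simp only [Finset.mem_product, Finite.mem_toFinset, mem_indepSets] at hq
      obtain ⟨hx, hJ⟩ := hq
      have := (contract_closure_indep_iff hx).1 hJ
      simp only [Finset.mem_filter, mem_indepSets, Finset.coe_insert]
      exact ⟨this.1, not_disjoint_iff.2 ⟨x, mem_insert _ _, hx⟩⟩
    · intro I hI
      simp only [Finset.mem_filter, mem_indepSets] at hI
      have hne : ((I : Set α) ∩ M.closure {e}).Nonempty := not_disjoint_iff_nonempty_inter.1 hI.2
      simp only [dif_pos hne, Finset.mem_product, Finite.mem_toFinset, mem_indepSets]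
      refine ⟨hne.some_mem.2, (contract_closure_indep_iff hne.some_mem.2).2 ⟨?_, ?_⟩⟩
      · refine hI.1.subset (insert_subset hne.some_mem.1 fun y hy => ?_)
        exact (Finset.mem_filter.1 (Finset.mem_coe.1 hy)).1
      · exact disjoint_left.2 fun x hx hx' => (Finset.mem_filter.1 hx').2 hx
    · rintro ⟨x, J⟩ hq
      simp only [Finset.mem_product, Finite.mem_toFinset, mem_indepSets] at hq
      obtain ⟨hx, hJ⟩ := hq
      obtain ⟨h1, h2⟩ := (contract_closure_indep_iff hx).1 hJ
      have hne : (((insert x J : Finset α) : Set α) ∩ M.closure {e}).Nonempty := ⟨x, by simp, hx⟩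
      have hs : hne.some = x := by
        refine subsingleton_inter_closure (M := M) (e := e) ?_ hne.some_mem ⟨by simp, hx⟩
        simpa using h1
      refine Prod.ext ?_ ?_
      · simp only [dif_pos hne, hs]
      · ext y
        have := fun hy : y ∈ J => fun hy' : y ∈ M.closure {e} => disjoint_left.1 h2 hy' hy
        simp only [Finset.mem_filter, Finset.mem_insert]
        constructor
        · rintro ⟨rfl | h, h'⟩
          · exact absurd hx h'
          · exact h
        · exact fun hy => ⟨Or.inr hy, this hy⟩
    · intro I hI
      simp only [Finset.mem_filter, mem_indepSets] at hI
      have hne : ((I : Set α) ∩ M.closure {e}).Nonempty := not_disjoint_iff_nonempty_inter.1 hI.2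
      simp only [dif_pos hne]
      ext y
      simp only [Finset.mem_filter, Finset.mem_insert]
      constructor
      · rintro (rfl | h)
        · exact hne.some_mem.1
        · exact h.1
      · intro hy
        by_cases hyc : y ∈ M.closure {e}
        · exact Or.inl (subsingleton_inter_closure hI.1 ⟨hy, hyc⟩ hne.some_mem)
        · exact Or.inr ⟨hy, hyc⟩
    · rintro ⟨x, J⟩ hq
      simp only [Finset.mem_product, Finite.mem_toFinset, mem_indepSets] at hq
      have := (contract_closure_indep_iff hq.1).1 hq.2
      rw [Finset.card_insert_of_notMem]
      exact fun h => disjoint_left.1 this.2 hq.1 h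
  rw [h1, sub_eq_add_neg, h2, altSum, Finset.sum_filter_add_sum_filter_not]

/-- The top `h`-number `(-1)^d ∑ (-1)^{|I|}` of a matroid of rank `d`. -/
noncomputable def topH (M : Matroid α) [M.Finite] (d : ℕ) : ℤ := (-1) ^ d * altSum M

/-- `M` is a partition matroid with `d` classes, one of size `k + 1` and the others of size `2`. -/
def IsPartitionLike (M : Matroid α) (d : ℕ) (k : ℤ) : Prop :=
  ∃ (c : α → Fin d) (i₀ : Fin d), (∀ I ⊆ M.E, M.Indep I ↔ InjOn c I) ∧
    ∀ i, ((M.E ∩ c ⁻¹' {i}).ncard : ℤ) = if i = i₀ then k + 1 else 2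

/-- The index `d + 1` is the rank of the deletion only when some base avoids the class; the other
case is `topH_of_forall_not_disjoint`. -/
theorem topH_eq_delete_add_contract {M : Matroid α} [M.Finite] [M.Loopless] {e : α} {d : ℕ} :
    topH M (d + 1) = topH (M.delete (M.closure {e})) (d + 1)
      + (M.closure {e}).ncard * topH (M.contract (M.closure {e})) d := by
  rw [topH, altSum_eq_delete_sub_contract M (e := e), topH, topH]
  ring

theorem topH_of_forall_not_disjoint {M : Matroid α} [M.Finite] [M.Loopless] {e : α} {d : ℕ}
    (he : e ∈ M.E) (h : ∀ B, M.IsBase B → ¬ Disjoint B (M.closure {e})) :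
    topH M (d + 1) = ((M.closure {e}).ncard - 1) * topH (M.contract (M.closure {e})) d := by
  rw [topH, altSum_eq_delete_sub_contract M (e := e), topH,
    altSum_congr (delete_indep_iff_contract_indep he h)]
  ring

theorem indep_iff_of_forall_not_disjoint {M : Matroid α} [M.Loopless] {e : α} (he : e ∈ M.E)
    (h : ∀ B, M.IsBase B → ¬ Disjoint B (M.closure {e})) (I : Set α) :
    M.Indep I ↔ (I ∩ M.closure {e}).Subsingleton ∧
      (M.contract (M.closure {e})).Indep (I \ M.closure {e}) := by
  constructor
  · intro hI
    refine ⟨subsingleton_inter_closure hI, ?_⟩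
    rw [← delete_indep_iff_contract_indep he h, Matroid.delete_indep_iff]
    exact ⟨hI.subset sdiff_subset, disjoint_sdiff_left⟩
  · rintro ⟨h1, h2⟩
    rcases (I ∩ M.closure {e}).eq_empty_or_nonempty with h0 | ⟨x, hxI, hx⟩
    · rw [sdiff_eq_left.2 (disjoint_iff_inter_eq_empty.2 h0)] at h2
      exact h2.of_contract
    · refine ((contract_closure_indep_iff hx).1 h2).1.subset fun y hy => ?_
      by_cases hyc : y ∈ M.closure {e}
      · exact Or.inl (h1 ⟨hy, hyc⟩ ⟨hxI, hx⟩)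
      · exact Or.inr ⟨hy, hyc⟩

/-! ### Partition matroids and degenerate cases -/

theorem isPartitionLike_of_contract {M : Matroid α} [M.Loopless] {e : α} {d : ℕ} {b : ℤ}
    (he : e ∈ M.E) (h : ∀ B, M.IsBase B → ¬ Disjoint B (M.closure {e}))
    (hb : b = 1 ∨ (M.closure {e}).ncard = 2)
    (hc : IsPartitionLike (M.contract (M.closure {e})) d b) :
    IsPartitionLike M (d + 1) (((M.closure {e}).ncard - 1) * b) := by
  classical
  obtain ⟨c, i₀, hc1, hc2⟩ := hc
  set P := M.closure {e} with hP
  have hPE : P ⊆ M.E := M.closure_subset_ground _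
  -- If `b = 1`, all classes of the contraction are pairs and the new class is the exceptional one;
  -- otherwise the new class is a pair and the old exceptional class, of size `b + 1`, remains so.
  refine ⟨fun x => if x ∈ P then 0 else (c x).succ, if b = 1 then 0 else i₀.succ, ?_, ?_⟩
  · intro I hI
    rw [indep_iff_of_forall_not_disjoint he h, ← hP,
      hc1 _ (by simpa using sdiff_subset_sdiff_left hI)]
    constructor
    · rintro ⟨h1, h2⟩ x hx y hy hxy
      by_cases hxP : x ∈ P <;> by_cases hyP : y ∈ P
      · exact h1 ⟨hx, hxP⟩ ⟨hy, hyP⟩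
      · simp only [hxP, hyP, if_true, if_false] at hxy
        exact absurd hxy.symm (Fin.succ_ne_zero _)
      · simp only [hxP, hyP, if_true, if_false] at hxy
        exact absurd hxy (Fin.succ_ne_zero _)
      · simp only [hxP, hyP, if_false] at hxy
        exact h2 ⟨hx, hxP⟩ ⟨hy, hyP⟩ (Fin.succ_injective _ hxy)
    · intro h1
      refine ⟨fun x hx y hy => h1 hx.1 hy.1 (by simp [hx.2, hy.2]), fun x hx y hy hxy => ?_⟩
      exact h1 hx.1 hy.1 (by simp [hx.2, hy.2, hxy])
  · intro i
    induction i using Fin.cases with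
    | zero =>
      have : M.E ∩ (fun x => if x ∈ P then 0 else (c x).succ) ⁻¹' {0} = P := by
        ext x
        by_cases hx : x ∈ P
        · simp [hx, hPE hx]
        · simp [hx]
      rw [this]
      by_cases hb1 : b = 1
      · simp [hb1]
      · have := hb.resolve_left hb1
        simp [hb1, this, (Fin.succ_ne_zero i₀).symm]
    | succ i =>
      have : M.E ∩ (fun x => if x ∈ P then 0 else (c x).succ) ⁻¹' {i.succ} =
          (M.contract P).E ∩ c ⁻¹' {i} := by
        ext x
        by_cases hx : x ∈ P
        · simp [hx, (Fin.succ_ne_zero i).symm]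
        · simp [hx]
      rw [this, hc2]
      by_cases hb1 : b = 1
      · simp [hb1]
      · have := hb.resolve_left hb1
        simp [hb1, this]

theorem isPartitionLike_of_ground_subset {M : Matroid α} [M.Loopless] {e : α}
    (h : M.E ⊆ M.closure {e}) : IsPartitionLike M 1 (M.E.ncard - 1) := by
  refine ⟨fun _ => 0, 0, fun I hI => ⟨fun hind x hx y hy _ => ?_, fun hinj => ?_⟩, fun i => ?_⟩
  · exact subsingleton_inter_closure hind ⟨hx, h (hI hx)⟩ ⟨hy, h (hI hy)⟩
  · exact Matroid.subsingleton_indep (fun x hx y hy => hinj hx hy rfl) hI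
  · simp [Subsingleton.elim i 0]

theorem ground_eq_empty_of_eRank_eq_zero {M : Matroid α} [M.Loopless] (h : M.eRank = 0) :
    M.E = ∅ := by
  refine eq_empty_of_forall_notMem fun x hx => ?_
  have := (M.isNonloop_of_loopless hx).indep.encard_le_eRank
  simp [h] at this

theorem topH_zero {M : Matroid α} [M.Finite] (h : M.E = ∅) : topH M 0 = 1 := by
  have : indepSets M = {∅} := by
    ext I
    rw [mem_indepSets, Finset.mem_singleton]
    constructor
    · intro hI
      have := hI.subset_ground
      rw [h, subset_empty_iff] at this
      exact_mod_cast this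
    · rintro rfl
      simp
  simp [topH, altSum, this]

theorem one_lt_ncard_closure {M : Matroid α} [M.Finite] {e : α} (he : e ∈ M.E)
    (hc : M.coloops = ∅) (h : ∀ B, M.IsBase B → ¬ Disjoint B (M.closure {e})) :
    2 ≤ (M.closure {e}).ncard := by
  have hee : e ∈ M.closure {e} := M.mem_closure_of_mem (mem_singleton e) (by simpa using he)
  have hfin : (M.closure {e}).Finite := M.ground_finite.subset (M.closure_subset_ground _)
  by_contra! hlt
  have hs : M.closure {e} = {e} :=
    eq_singleton_iff_unique_mem.2
      ⟨hee, fun x hx => (ncard_le_one hfin).1 (by omega) x hx e hee⟩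
  have : M.IsColoop e := by
    rw [Matroid.isColoop_iff_forall_mem_isBase]
    intro B hB
    have := h B hB
    rwa [hs, disjoint_singleton_right, not_not] at this
  rw [Matroid.isColoop_iff_mem_coloops, hc] at this
  exact this

/-- A coloop is a parallel class of size 1 met by every base, so the factor `|P| - 1` vanishes. -/
theorem topH_eq_zero_of_coloop {M : Matroid α} [M.Finite] [M.Loopless] {d : ℕ}
    (hr : M.eRank = d) (hc : M.coloops ≠ ∅) : topH M d = 0 := by
  obtain ⟨e, he⟩ := nonempty_iff_ne_empty.2 hc
  have heE := M.coloops_subset_ground he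
  have hcl : M.closure {e} = {e} := by
    rw [Matroid.closure_eq_of_subset_coloops (by simpa using he), M.loops_eq_empty, union_empty]
  rcases d with _ | d
  · rw [ground_eq_empty_of_eRank_eq_zero (by simpa using hr)] at heE
    exact absurd heE (notMem_empty e)
  · rw [topH_of_forall_not_disjoint heE]
    · simp [hcl]
    · intro B hB
      rw [hcl, disjoint_singleton_right, not_not]
      exact hB.coloops_subset he

/-! ### The inductive bound and its equality case -/

/-- Nonnegativity is kept free of the coloop condition because deleting a class may create coloops,
whereas contraction does not. The condition `1 ≤ d` is needed since `IsPartitionLike M 0` is false: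
it asks for an element of `Fin 0`. -/
theorem topH_bounds (n : ℕ) : ∀ (M : Matroid α) [M.Finite] [M.Loopless] (d : ℕ),
    M.E.ncard = n → M.eRank = d → 0 ≤ topH M d ∧ (M.coloops = ∅ → 1 ≤ topH M d ∧
      (1 ≤ d → (n : ℤ) ≤ 2 * d + topH M d - 1 ∧
        ((n : ℤ) = 2 * d + topH M d - 1 → IsPartitionLike M d (topH M d)))) := by
  induction n using Nat.strong_induction_on with
  | _ n ih =>
  intro M _ _ d hn hr
  rcases d with _ | d
  · simp [topH_zero (ground_eq_empty_of_eRank_eq_zero (by simpa using hr))]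
  obtain ⟨e, he⟩ : M.E.Nonempty := by
    by_contra h0
    have := M.eRank_le_encard_ground
    rw [hr, not_nonempty_iff_eq_empty.1 h0] at this
    simp at this
  have hee : e ∈ M.closure {e} := M.mem_closure_of_mem (mem_singleton e) (by simpa using he)
  have hPE : M.closure {e} ⊆ M.E := M.closure_subset_ground _
  have hfin : (M.closure {e}).Finite := M.ground_finite.subset hPE
  have hp1 : 1 ≤ (M.closure {e}).ncard := (ncard_pos hfin).2 ⟨e, hee⟩
  have hsum : (M.E \ M.closure {e}).ncard + (M.closure {e}).ncard = n := by
    rw [← hn]; exact ncard_sdiff_add_ncard_of_subset hPE M.ground_finite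
  have hrc : (M.contract (M.closure {e})).eRank = d := by
    have := eRank_contract_closure he
    rw [hr] at this
    push_cast at this
    exact ENat.add_left_injective_of_ne_top ENat.one_ne_top this
  have := contract_closure_loopless M {e}
  have := delete_loopless M (M.closure {e})
  obtain ⟨hc0, hc1⟩ := ih _ (show (M.E \ M.closure {e}).ncard < n by omega) (M.contract (M.closure {e})) d rfl hrc
  have hcn : (M.contract (M.closure {e})).E.ncard + (M.closure {e}).ncard = n := hsum
  have hcc : M.coloops = ∅ → (M.contract (M.closure {e})).coloops = ∅ := fun h => by
    rw [Matroid.contract_coloops_eq, h, empty_sdiff]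
  have hz : d = 0 → M.E \ M.closure {e} = ∅ := fun h0 =>
    ground_eq_empty_of_eRank_eq_zero (M := M.contract (M.closure {e})) (by simp [hrc, h0])
  by_cases hB : ∃ B, M.IsBase B ∧ Disjoint B (M.closure {e})
  · obtain ⟨B, hB, hBd⟩ := hB
    obtain ⟨hd0, -⟩ := ih _ (show (M.E \ M.closure {e}).ncard < n by omega) (M.delete (M.closure {e})) (d + 1) rfl
      ((eRank_delete_of_disjoint hB hBd).trans hr)
    rw [topH_eq_delete_add_contract (e := e)]
    refine ⟨by positivity, fun hco => ?_⟩
    obtain ⟨hb, hb'⟩ := hc1 (hcc hco)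
    -- This is `(|P| - 1)(b - 1) ≥ 0` for `b` the top `h`-number of the contraction.
    have hge : (M.closure {e}).ncard + topH (M.contract (M.closure {e})) d - 1 ≤
        (M.closure {e}).ncard * topH (M.contract (M.closure {e})) d := by
      have : (1 : ℤ) ≤ (M.closure {e}).ncard := by exact_mod_cast hp1
      nlinarith
    have hp1' : (1 : ℤ) ≤ (M.closure {e}).ncard := by exact_mod_cast hp1
    refine ⟨by linarith, fun _ => ?_⟩
    have hlt : (n : ℤ) < 2 * ((d + 1 : ℕ) : ℤ) + (topH (M.delete (M.closure {e})) (d + 1) +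
        (M.closure {e}).ncard * topH (M.contract (M.closure {e})) d) - 1 := by
      rcases Nat.eq_zero_or_pos d with h0 | hpos
      · rw [hz h0, ncard_empty] at hsum
        subst h0
        push_cast
        have : ((M.closure {e}).ncard : ℤ) = n := by exact_mod_cast (by omega)
        linarith
      · have := (hb' hpos).1
        have h2 : (((M.contract (M.closure {e})).E.ncard : ℤ)) + (M.closure {e}).ncard = n := by
          exact_mod_cast hcn
        push_cast
        linarith
    exact ⟨hlt.le, fun h => absurd h hlt.ne⟩
  · push Not at hB
    have hB' : ∀ B, M.IsBase B → ¬ Disjoint B (M.closure {e}) := hB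
    rw [topH_of_forall_not_disjoint he hB']
    have hp1' : (1 : ℤ) ≤ (M.closure {e}).ncard := by exact_mod_cast hp1
    refine ⟨mul_nonneg (by linarith) hc0, fun hco => ?_⟩
    obtain ⟨hb, hb'⟩ := hc1 (hcc hco)
    have hp2 : (2 : ℤ) ≤ (M.closure {e}).ncard := by
      exact_mod_cast one_lt_ncard_closure he hco hB'
    refine ⟨by nlinarith, fun _ => ?_⟩
    rcases Nat.eq_zero_or_pos d with h0 | hpos
    · subst h0
      have hsub := hz rfl
      rw [hsub, ncard_empty] at hsum
      have hpn : ((M.closure {e}).ncard : ℤ) = n := by exact_mod_cast (by omega)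
      rw [topH_zero (M := M.contract (M.closure {e})) hsub, hpn]
      refine ⟨by push_cast; linarith, fun _ => ?_⟩
      have := isPartitionLike_of_ground_subset (sdiff_eq_empty.1 hsub)
      rwa [hn, ← mul_one ((n : ℤ) - 1)] at this
    · obtain ⟨h1, h2⟩ := hb' hpos
      have h3 : (((M.contract (M.closure {e})).E.ncard : ℤ)) + (M.closure {e}).ncard = n := by
        exact_mod_cast hcn
      set b := topH (M.contract (M.closure {e})) d
      -- This product is exactly the slack added when passing from the contraction to `M`, so it
      -- vanishes in the equality case.
      have h4 : 0 ≤ (((M.closure {e}).ncard : ℤ) - 2) * (b - 1) :=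
        mul_nonneg (by linarith) (by linarith)
      push_cast
      refine ⟨by linarith, fun heq => ?_⟩
      have h5 : (((M.closure {e}).ncard : ℤ) - 2) * (b - 1) = 0 := by linarith
      refine isPartitionLike_of_contract he hB' ?_ (h2 (by linarith))
      rcases mul_eq_zero.1 h5 with h6 | h6
      · right; exact_mod_cast (by linarith : ((M.closure {e}).ncard : ℤ) = 2)
      · left; linarith

/-! ### Face numbers of the independence complex -/

theorem mem_indepComplex {M : Matroid α} {F : Finset α} :
    F ∈ indepComplex M ↔ M.Indep (F : Set α) := Iff.rfl

theorem eRank_eq_maxCard (M : Matroid α) [M.Finite] :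
    M.eRank = maxCard (indepComplex M) := by
  obtain ⟨B, hB⟩ := M.exists_isBase
  have hfin : B.Finite := M.ground_finite.subset hB.subset_ground
  have hcard : ((hfin.toFinset.card : ℕ) : ℕ∞) = M.eRank := by
    rw [← hB.encard_eq_eRank, hfin.encard_eq_coe_toFinset_card]
  rw [← hcard, Nat.cast_inj]
  refine (IsGreatest.csSup_eq (a := hfin.toFinset.card)
    (⟨⟨hfin.toFinset, ?_, rfl⟩, ?_⟩ : IsGreatest {n | ∃ F ∈ indepComplex M, F.card = n} _)).symm
  · rw [mem_indepComplex, hfin.coe_toFinset]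
    exact hB.indep
  · rintro n ⟨F, hF, rfl⟩
    have := Matroid.Indep.encard_le_eRank hF
    rw [← hcard, encard_coe_eq_coe_finsetCard] at this
    exact_mod_cast this

theorem eRank_eq_of_dim {M : Matroid α} [M.Finite] {d : ℕ}
    (h : dim (indepComplex M) = (d : ℤ) - 1) : M.eRank = d := by
  rw [eRank_eq_maxCard, Nat.cast_inj]
  unfold dim at h
  omega

theorem fNumber_indepComplex (M : Matroid α) [M.Finite] (i : ℕ) :
    fNumber (indepComplex M) ((i : ℤ) - 1) = ((indepSets M).filter (·.card = i)).card := by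
  rw [fNumber, ← ncard_coe_finset]
  congr 1
  ext F
  simp [mem_indepComplex]

theorem fNumber_zero (M : Matroid α) [M.Loopless] :
    fNumber (indepComplex M) 0 = M.E.ncard := by
  rw [fNumber, ← ncard_image_of_injective M.E Finset.singleton_injective]
  congr 1
  ext F
  simp only [mem_ofPred_eq, mem_image, mem_indepComplex]
  constructor
  · rintro ⟨h1, h2⟩
    obtain ⟨x, rfl⟩ := Finset.card_eq_one.1 (by omega : F.card = 1)
    exact ⟨x, h1.subset_ground (by simp), rfl⟩
  · rintro ⟨x, hx, rfl⟩
    exact ⟨by simpa using M.isNonloop_of_loopless hx, by simp⟩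

theorem sum_fNumber (M : Matroid α) [M.Finite] :
    ∑ i ∈ Finset.range (maxCard (indepComplex M) + 1),
      (-1) ^ i * (fNumber (indepComplex M) ((i : ℤ) - 1) : ℤ) = altSum M := by
  rw [altSum, ← Finset.sum_fiberwise_of_maps_to (g := Finset.card)
    (t := Finset.range (maxCard (indepComplex M) + 1))]
  · refine Finset.sum_congr rfl fun i _ => ?_
    rw [fNumber_indepComplex, Finset.sum_congr rfl
      (g := fun _ => (-1 : ℤ) ^ i) (fun F hF => by rw [(Finset.mem_filter.1 hF).2])]
    rw [Finset.sum_const, nsmul_eq_mul, mul_comm]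
  · intro F hF
    have := (mem_indepSets.1 hF).encard_le_eRank
    rw [eRank_eq_maxCard, encard_coe_eq_coe_finsetCard, Nat.cast_le] at this
    exact Finset.mem_range.2 (by omega)

theorem reducedEuler_indepComplex (M : Matroid α) [M.Finite] :
    reducedEuler (indepComplex M) = - altSum M := by
  rw [← sum_fNumber, reducedEuler, ← Finset.sum_neg_distrib]
  exact Finset.sum_congr rfl fun i _ => by ring

theorem coeff_one_sub_X_pow (n : ℕ) : ((1 - X : ℤ[X]) ^ n).coeff n = (-1) ^ n := by
  have h : (1 - X : ℤ[X]) = C (-1) * X + C 1 := by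
    simp only [C_neg, C_1]; ring
  have hd : (1 - X : ℤ[X]).natDegree ≤ 1 := by
    rw [h]; exact natDegree_linear_le
  have := coeff_pow_of_natDegree_le (m := n) hd
  rw [mul_one] at this
  rw [this, h]
  simp [coeff_one]

/-- The coefficient of `t^d` in `t^i (1 - t)^(d - i)` is `(-1)^(d - i)`, which has the sign of
`(-1)^d (-1)^i`. -/
theorem hNumber_indepComplex {M : Matroid α} [M.Finite] {d : ℕ} (hr : M.eRank = d) :
    hNumber (indepComplex M) d = topH M d := by
  have hm : maxCard (indepComplex M) = d := by
    rw [eRank_eq_maxCard] at hr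
    exact_mod_cast hr
  rw [hNumber, hPoly, topH, ← sum_fNumber, hm, finsetSum_coeff, Finset.mul_sum]
  refine Finset.sum_congr rfl fun i hi => ?_
  obtain ⟨j, rfl⟩ := Nat.exists_eq_add_of_le (Nat.lt_succ_iff.1 (Finset.mem_range.1 hi))
  rw [mul_assoc, coeff_C_mul, add_tsub_cancel_left, add_comm i j, coeff_X_pow_mul,
    coeff_one_sub_X_pow, pow_add]
  have : ((-1 : ℤ) ^ i) * (-1) ^ i = 1 := by rw [← mul_pow]; simp
  linear_combination (-(fNumber (indepComplex M) ((i : ℤ) - 1) : ℤ) * (-1) ^ j) * this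

theorem abs_reducedEuler {M : Matroid α} [M.Finite] (d : ℕ) :
    |reducedEuler (indepComplex M)| = |topH M d| := by
  rw [reducedEuler_indepComplex, topH, abs_neg, abs_mul, abs_pow, abs_neg, abs_one, one_pow,
    one_mul]

/-! ### The matroid `V d k` -/

theorem V_ground (d k : ℕ) : (V d k).E = univ := rfl

theorem V_indep_iff {d k : ℕ} {F : Set (VEdge d k)} :
    (V d k).Indep F ↔ InjOn Sigma.fst F := not_containsCycle_vGraph_iff

instance V_finite (d k : ℕ) : (V d k).Finite := ⟨finite_univ⟩

instance V_loopless (d k : ℕ) : (V d k).Loopless := by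
  rw [Matroid.loopless_iff_forall_isNonloop]
  intro e _
  rw [← Matroid.indep_singleton, V_indep_iff]
  exact injOn_singleton _ _

theorem V_eRank {d k : ℕ} : (V d k).eRank = d := by
  have h0 (i : Fin d) : 0 < if (i : ℕ) = 0 then k + 1 else 2 := by split_ifs <;> omega
  let s : Fin d → VEdge d k := fun i => ⟨i, ⟨0, h0 i⟩⟩
  have hs : Function.Injective s := fun i j h => congrArg Sigma.fst h
  have hB : (V d k).IsBase (range s) := by
    refine Matroid.Indep.isBase_of_maximal ?_ ?_
    · rw [V_indep_iff]
      rintro _ ⟨i, rfl⟩ _ ⟨j, rfl⟩ h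
      exact congrArg s h
    · intro J hJ hsub
      rw [V_indep_iff] at hJ
      exact hsub.antisymm fun x hx => ⟨x.1, hJ (hsub ⟨x.1, rfl⟩) hx rfl⟩
  rw [← hB.encard_eq_eRank, ← image_univ, hs.encard_image, encard_univ]
  simp

theorem prod_ite_zero {d : ℕ} (a b : ℤ) :
    ∏ i : Fin (d + 1), (if (i : ℕ) = 0 then a else b) = a * b ^ d := by
  rw [Fin.prod_univ_succ]
  simp

theorem sum_ite_zero {d : ℕ} (a b : ℕ) :
    ∑ i : Fin (d + 1), (if (i : ℕ) = 0 then a else b) = a + d * b := by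
  rw [Fin.sum_univ_succ]
  simp

theorem V_ncard {d k : ℕ} (hd : 1 ≤ d) : (((V d k).E.ncard : ℕ) : ℤ) = 2 * d + k - 1 := by
  obtain ⟨d, rfl⟩ := Nat.exists_eq_add_of_le' hd
  rw [V_ground, ncard_univ, Nat.card_eq_fintype_card, Fintype.card_sigma]
  simp only [Fintype.card_fin]
  rw [sum_ite_zero]
  push_cast
  ring

/-- The independent sets of `V d k` correspond to the partial sections of `Sigma.fst`. -/
theorem altSum_V (d k : ℕ) :
    altSum (V d k) = ∏ i : Fin d, (1 - ((if (i : ℕ) = 0 then k + 1 else 2 : ℕ) : ℤ)) := by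
  classical
  -- Choosing `none` leaves class `i` unused and contributes `1`; each choice of an edge contributes
  -- `-1`. Expanding the product then sums over partial sections.
  have h1 (i : Fin d) : (1 - ((if (i : ℕ) = 0 then k + 1 else 2 : ℕ) : ℤ)) =
      ∑ o : Option (Fin (if (i : ℕ) = 0 then k + 1 else 2)), if o = none then 1 else -1 := by
    rw [Fintype.sum_option]
    simp [sub_eq_add_neg]
  simp only [h1]
  rw [Finset.prod_univ_sum, altSum]
  let S : (∀ i : Fin d, Option (Fin (if (i : ℕ) = 0 then k + 1 else 2))) → Finset (VEdge d k) :=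
    fun f => Finset.univ.filter fun x => f x.1 = some x.2
  have memS (f) (x : VEdge d k) : x ∈ S f ↔ f x.1 = some x.2 := by simp [S]
  symm
  refine Finset.sum_bij (fun f _ => S f) ?_ ?_ ?_ ?_
  · intro f _
    rw [mem_indepSets, V_indep_iff]
    rintro ⟨i, x⟩ hx ⟨j, y⟩ hy hij
    obtain rfl : i = j := hij
    rw [Finset.mem_coe, memS] at hx hy
    exact congrArg (Sigma.mk i) (Option.some_injective _ (hx.symm.trans hy))
  · intro f _ g _ hfg
    funext i
    refine Option.ext fun x => ?_
    have := Finset.ext_iff.1 hfg ⟨i, x⟩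
    simpa only [memS] using this
  · intro F hF
    rw [mem_indepSets, V_indep_iff] at hF
    let g : ∀ i : Fin d, Option (Fin (if (i : ℕ) = 0 then k + 1 else 2)) :=
      fun i => if h : ∃ x, (⟨i, x⟩ : VEdge d k) ∈ F then some h.choose else none
    refine ⟨g, by simp, Finset.ext fun ⟨i, x⟩ => (memS g ⟨i, x⟩).trans ?_⟩
    change (if h : ∃ x, (⟨i, x⟩ : VEdge d k) ∈ F then some h.choose else none) = some x ↔ _
    constructor
    · intro h
      by_cases h' : ∃ x, (⟨i, x⟩ : VEdge d k) ∈ F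
      · rw [dif_pos h'] at h
        have := h'.choose_spec
        rwa [Option.some_injective _ h] at this
      · simp [dif_neg h'] at h
    · intro h
      have h' : ∃ x, (⟨i, x⟩ : VEdge d k) ∈ F := ⟨x, h⟩
      rw [dif_pos h']
      have := hF h'.choose_spec h rfl
      rw [eq_of_heq (Sigma.mk.inj this).2]
  · intro f _
    have : (S f).card = (Finset.univ.filter fun i => ¬ f i = none).card := by
      refine Finset.card_bij (fun x _ => x.1) ?_ ?_ ?_
      · intro x hx
        simp [(memS f x).1 hx]
      · rintro ⟨i, x⟩ hx ⟨j, y⟩ hy hij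
        obtain rfl : i = j := hij
        rw [memS] at hx hy
        exact congrArg (Sigma.mk i) (Option.some_injective _ (hx.symm.trans hy))
      · intro i hi
        obtain ⟨x, hx⟩ := Option.ne_none_iff_exists'.1 (Finset.mem_filter.1 hi).2
        exact ⟨⟨i, x⟩, (memS f ⟨i, x⟩).2 hx, rfl⟩
    rw [this, Finset.prod_ite]
    simp

theorem topH_V {d k : ℕ} (hd : 1 ≤ d) : topH (V d k) d = k := by
  obtain ⟨d, rfl⟩ := Nat.exists_eq_add_of_le' hd
  rw [topH, altSum_V]
  have (i : Fin (d + 1)) : (1 - ((if (i : ℕ) = 0 then k + 1 else 2 : ℕ) : ℤ)) =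
      if (i : ℕ) = 0 then -(k : ℤ) else -1 := by
    split_ifs <;> simp
  simp only [this]
  rw [prod_ite_zero, pow_succ]
  have h : ((-1 : ℤ) ^ d) * (-1) ^ d = 1 := by rw [← mul_pow]; simp
  linear_combination (k : ℤ) * h

theorem V_memPsi {d k : ℕ} (hd : 1 ≤ d) : MemPsi (V d k) d k := by
  refine ⟨inferInstance, inferInstance, ?_, ?_⟩
  · have h := V_eRank (d := d) (k := k)
    rw [eRank_eq_maxCard, Nat.cast_inj] at h
    rw [dim, h]
  · rw [abs_reducedEuler d, topH_V hd, Nat.abs_cast]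

/-! ### Isomorphism with `V d k` -/

theorem IsPartitionLike.isIso {M : Matroid α} [M.Finite] {d k : ℕ}
    (h : IsPartitionLike M d k) : IsIso M (V d k) := by
  classical
  obtain ⟨c, i₀, hc, hn⟩ := h
  have hd : 0 < d := i₀.pos
  let z : Fin d := ⟨0, hd⟩
  -- The swap moves the exceptional class to position `0`, where `V d k` has its `k + 1` parallel
  -- edges.
  let c' : M.E → Fin d := fun x => Equiv.swap z i₀ (c x)
  have : Finite M.E := M.ground_finite
  have hfib (i : Fin d) : Nonempty ({x : M.E // c' x = i} ≃
      {y : (V d k).E // y.1.1 = i}) := by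
    refine ⟨(Finite.equivFinOfCardEq (α := {x : M.E // c' x = i})
      (n := if (i : ℕ) = 0 then k + 1 else 2) ?_).trans ?_⟩
    · have e1 : {x : M.E // c' x = i} ≃ (M.E ∩ c ⁻¹' {Equiv.swap z i₀ i} : Set α) :=
        (Equiv.subtypeSubtypeEquivSubtypeInter (· ∈ M.E)
          (fun x => Equiv.swap z i₀ (c x) = i)).trans
        (Equiv.subtypeEquivRight fun x => by
          simp [Equiv.swap_apply_eq_iff])
      rw [Nat.card_congr e1, Nat.card_coe_set_eq]
      have := hn (Equiv.swap z i₀ i)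
      have hiff : Equiv.swap z i₀ i = i₀ ↔ (i : ℕ) = 0 := by
        rw [Equiv.swap_apply_eq_iff, Equiv.swap_apply_right, Fin.ext_iff]
      simp only [hiff] at this
      split_ifs at this ⊢ <;> exact_mod_cast this
    · exact
        { toFun := fun x => ⟨⟨⟨i, x⟩, mem_univ _⟩, rfl⟩
          invFun := fun y => y.2 ▸ y.1.1.2
          left_inv := fun x => rfl
          right_inv := by rintro ⟨⟨⟨j, y⟩, _⟩, rfl⟩; rfl }
  let F (i : Fin d) := (hfib i).some
  let e : M.E ≃ (V d k).E := (Equiv.sigmaFiberEquiv c').symm.trans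
    ((Equiv.sigmaCongrRight F).trans (Equiv.sigmaFiberEquiv fun y : (V d k).E => y.1.1))
  have he (x : M.E) : (e x).1.1 = c' x := (F (c' x) ⟨x, rfl⟩).2
  refine ⟨e, fun I => ?_⟩
  rw [hc _ (by rintro _ ⟨x, -, rfl⟩; exact x.2), V_indep_iff]
  constructor
  · rintro h _ ⟨_, ⟨x, hx, rfl⟩, rfl⟩ _ ⟨_, ⟨y, hy, rfl⟩, rfl⟩ hxy
    rw [he, he] at hxy
    rw [Subtype.ext (h ⟨x, hx, rfl⟩ ⟨y, hy, rfl⟩ ((Equiv.injective _) hxy))]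
  · rintro h _ ⟨x, hx, rfl⟩ _ ⟨y, hy, rfl⟩ hxy
    have h1 : (e x).1.1 = (e y).1.1 := by
      rw [he, he]
      exact congrArg (Equiv.swap z i₀) hxy
    have h2 := h ⟨_, ⟨x, hx, rfl⟩, rfl⟩ ⟨_, ⟨y, hy, rfl⟩, rfl⟩ h1
    rw [e.injective (Subtype.ext h2)]

theorem isIso_V_of_ncard {M : Matroid α} [M.Finite] [M.Loopless] {d k : ℕ} (hd : 1 ≤ d)
    (hk : 1 ≤ k) (hr : M.eRank = d) (ht : topH M d = k) :
    (M.E.ncard : ℤ) ≤ 2 * d + k - 1 ∧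
      ((M.E.ncard : ℤ) = 2 * d + k - 1 → IsIso M (V d k)) := by
  have hc : M.coloops = ∅ := by
    by_contra hc
    have := topH_eq_zero_of_coloop hr hc
    omega
  have h := (((topH_bounds _ M d rfl hr).2 hc).2 hd)
  rw [ht] at h
  exact ⟨h.1, fun heq => (h.2 heq).isIso⟩

end ExtremalMatroid

theorem mainTheorem5 {α : Type*} (d k : ℕ) (hd : 1 ≤ d) (hk : 1 ≤ k) :
    (∀ M : Matroid α, M.Finite → M.Loopless →
      ExtremalMatroid.dim (ExtremalMatroid.indepComplex M) = (d : ℤ) - 1 →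
      ExtremalMatroid.hNumber (ExtremalMatroid.indepComplex M) d = (k : ℤ) →
      (ExtremalMatroid.fNumber (ExtremalMatroid.indepComplex M) 0 : ℤ)
        = 2 * d + ExtremalMatroid.hNumber (ExtremalMatroid.indepComplex M) d - 1 →
      ExtremalMatroid.IsIso M (ExtremalMatroid.V d k)) ∧
    (ExtremalMatroid.MemPsi (ExtremalMatroid.V d k) d k ∧
      ((ExtremalMatroid.V d k).E.ncard : ℤ) = 2 * d + k - 1 ∧
      ∀ M : Matroid α, ExtremalMatroid.MemPsi M d k →
        M.E.ncard ≤ (ExtremalMatroid.V d k).E.ncard ∧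
        (M.E.ncard = (ExtremalMatroid.V d k).E.ncard ↔
          ExtremalMatroid.IsIso M (ExtremalMatroid.V d k))) := by
  open ExtremalMatroid in
  refine ⟨fun M hf hl hdim hh hn => ?_, V_memPsi hd, V_ncard hd, fun M hM => ?_⟩
  · have hr := eRank_eq_of_dim hdim
    have ht := hh
    rw [hNumber_indepComplex hr] at ht
    rw [fNumber_zero, hh] at hn
    exact (isIso_V_of_ncard hd hk hr ht).2 hn
  · obtain ⟨hf, hl, hdim, hχ⟩ := hM
    have hr := eRank_eq_of_dim hdim
    -- Nonnegativity of the top `h`-number removes the absolute value.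
    have ht : topH M d = k := by
      rwa [abs_reducedEuler d, abs_of_nonneg (topH_bounds _ M d rfl hr).1] at hχ
    obtain ⟨h1, h2⟩ := isIso_V_of_ncard hd hk hr ht
    have hV := V_ncard (k := k) hd
    refine ⟨by omega, fun h => h2 (by omega), fun ⟨e, _⟩ => ?_⟩
    exact Nat.card_congr e
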